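/- Let $\mathcal G=\{G^{(t)}\}_{t=0}^{\infty}$ be an $n$-node dynamic network: a sequence of simple graphs on one fixed set $V$ of $n$ nodes, where $G^{(t)}$ is the underlying graph during the time interval $[t,t+1)$. The sequence may be fixed in advance; more generally $G^{(t)}$ may depend on the sets of nodes informed by the times $0,1,\dots,t$. In the asynchronous rumor spreading algorithm one node knows the rumor at time $0$, every node has an independent clock that ticks according to a Poisson process of rate $1$, and whenever the clock of a node ticks, the node contacts a uniformly random neighbor in the current graph (an isolated node contacts nobody); if at least one of the two knows the rumor, then afterwards both know it. For a graph $G=(V,E)$ with degrees $d_u$ let $$\overline\rho(G)=\min_{\{u,v\}\in E}\max\{1/d_u,1/d_v\}\quad(\overline\rho(G)=0 \text{ if } E=\emptyset),$$ and let $\lceil\Phi(G)\rceil=1$ if $G$ is connected and $\lceil\Phi(G)\rceil=0$ otherwise. Let $$T_{abs}(\mathcal G)=\min\Big\{t\in\{0,1,2,\dots\}:\ \sum_{p=0}^{t}\lceil\Phi(G^{(p)})\rceil\cdot\overline\rho(G^{(p)})\ge 2n\Big\}$$ (with $T_{abs}(\mathcal G)=\infty$ if there is no such $t$), computed for the graphs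 that are exposed in the run. For every constant $c>1$ there is $n_0=n_0(c)$ such that for every $n\ge n_0$, every $n$-node dynamic network $\mathcal G$ and every initially informed node, with probability at least $1-n^{-c}$ all nodes are informed by time $T_{abs}(\mathcal G)$. In particular there is an absolute constant $C$ such that for every constant $c>1$, all sufficiently large $n$ (depending only on $c$), every $n$-node dynamic network whose graphs $G^{(t)}$ are all connected and every initially informed node, with probability at least $1-n^{-c}$ all nodes are informed by time $Cn^2$. -/

import Mathlib

open MeasureTheory ProbabilityTheory
open scoped ENNReal NNReal

namespace AsyncRumor

/-! ### Graph parameters -/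

open Classical in
/-- The absolute diligence `min_{ {u,v} ∈ E } max {1/d_u, 1/d_v}`. The infimum is over a finite
set; for a graph without edges the set is empty and the value is `sInf ∅ = 0`, which is the
intended convention. -/
noncomputable def absDiligence {n : ℕ} (G : SimpleGraph (Fin n)) : ℝ :=
  sInf {x : ℝ | ∃ u v : Fin n, G.Adj u v ∧ x = max (1 / (G.degree u : ℝ)) (1 / (G.degree v : ℝ))}

open Classical in
/-- `⌈Φ(G)⌉`: equal to `1` if `G` is connected and to `0` otherwise. -/
noncomputable def ceilConductance {n : ℕ} (G : SimpleGraph (Fin n)) : ℝ :=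
  if G.Connected then 1 else 0

/-- `T_abs` of a sequence of graphs: the least `t` with
`∑_{p=0}^t ⌈Φ(G^(p))⌉ ρ̄(G^(p)) ≥ 2n`, and `⊤` if there is no such `t`. -/
noncomputable def Tabs {n : ℕ} (G : ℕ → SimpleGraph (Fin n)) : ℕ∞ :=
  ⨅ (t : ℕ) (_ : 2 * (n : ℝ) ≤
    ∑ p ∈ Finset.range (t + 1), ceilConductance (G p) * absDiligence (G p)), (t : ℕ∞)

/-! ### Dynamic networks and the asynchronous algorithm -/

/-- An `n`-node dynamic network. `𝒢 t h` is the graph exposed at the discrete time `t`. It is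
allowed to depend on `h`, the list `[I_t, I_{t-1}, …, I_0]` of the sets of nodes informed by the
times `t, t-1, …, 0`. A fixed sequence of graphs `G` is the dynamic network `fun t _ => G t`. -/
abbrev DynamicNetwork (n : ℕ) : Type := ℕ → List (Finset (Fin n)) → SimpleGraph (Fin n)

/-- The time of the tick number `k` (`k = 0, 1, …`) of the clock of `u`, where `wait u i` are the
successive waiting times of that clock. -/
noncomputable def tick {n : ℕ} (wait : Fin n → ℕ → ℝ) (u : Fin n) (k : ℕ) : ℝ :=
  ∑ i ∈ Finset.range (k + 1), wait u i

open Classical in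
/-- The clock of `u` ticks at time `s` and `u` then contacts its neighbour `v` in `G`:
at its tick number `k`, the node `u` contacts the node `choice u k S`,
where `S` is its current set of neighbours. -/
def Contacts {n : ℕ} (wait : Fin n → ℕ → ℝ) (choice : Fin n → ℕ → Finset (Fin n) → Fin n)
    (G : SimpleGraph (Fin n)) (s : ℝ) (u v : Fin n) : Prop :=
  ∃ k : ℕ, tick wait u k = s ∧ G.Adj u v ∧ choice u k (G.neighborFinset u) = v

/-- Spreading in the fixed graph `G` from time `a` on, when `I` is the set of nodes informed before
time `a`: `InformedBefore wait choice G a I τ v` says that `v` is informed before time `τ`, that is,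
it is in `I` or it exchanged the rumor at some time `s ∈ [a, τ)`, by a push or by a pull, with a
node that was informed before time `s`. -/
inductive InformedBefore {n : ℕ} (wait : Fin n → ℕ → ℝ)
    (choice : Fin n → ℕ → Finset (Fin n) → Fin n)
    (G : SimpleGraph (Fin n)) (a : ℝ) (I : Finset (Fin n)) : ℝ → Fin n → Prop
  | init {τ : ℝ} {v : Fin n} (hv : v ∈ I) (hτ : a ≤ τ) : InformedBefore wait choice G a I τ v
  | exchange {s τ : ℝ} {u v : Fin n} (hu : InformedBefore wait choice G a I s u) (hs : s < τ)
      (h : Contacts wait choice G s u v ∨ Contacts wait choice G s v u) :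
      InformedBefore wait choice G a I τ v

open Classical in
/-- The list `[I_t, …, I_0]` of the sets of informed nodes at the times `t, …, 0`, for the
algorithm started with the rumor at `v₀`. In the time interval `[t, t + 1)` the underlying graph is
`𝒢 t [I_t, …, I_0]`. -/
noncomputable def history {n : ℕ} (𝒢 : DynamicNetwork n) (v₀ : Fin n)
    (wait : Fin n → ℕ → ℝ) (choice : Fin n → ℕ → Finset (Fin n) → Fin n) :
    ℕ → List (Finset (Fin n))
  | 0 => [{v₀}]
  | t + 1 =>
    (Finset.univ.filter fun v =>
      InformedBefore wait choice (𝒢 t (history 𝒢 v₀ wait choice t)) (t : ℝ)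
        ((history 𝒢 v₀ wait choice t).headD ∅) ((t : ℝ) + 1) v) ::
      history 𝒢 v₀ wait choice t

/-- The graph `G^(t)` that is exposed at time `t` in a run of the algorithm. -/
noncomputable def graphAt {n : ℕ} (𝒢 : DynamicNetwork n) (v₀ : Fin n)
    (wait : Fin n → ℕ → ℝ) (choice : Fin n → ℕ → Finset (Fin n) → Fin n) (t : ℕ) :
    SimpleGraph (Fin n) :=
  𝒢 t (history 𝒢 v₀ wait choice t)

/-- All nodes are informed before the (real) time `τ ≥ 0`; the underlying graph at time `τ` is
`G^(⌊τ⌋)`. -/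
def AllInformedBefore {n : ℕ} (𝒢 : DynamicNetwork n) (v₀ : Fin n)
    (wait : Fin n → ℕ → ℝ) (choice : Fin n → ℕ → Finset (Fin n) → Fin n) (τ : ℝ≥0) : Prop :=
  ∀ v : Fin n, InformedBefore wait choice (graphAt 𝒢 v₀ wait choice ⌊τ⌋₊) (⌊τ⌋₊ : ℝ)
    ((history 𝒢 v₀ wait choice ⌊τ⌋₊).headD ∅) (τ : ℝ) v

/-- The first time at which all nodes are informed in a run of the algorithm
(`∞` if this never happens). -/
noncomputable def completionTime {n : ℕ} (𝒢 : DynamicNetwork n) (v₀ : Fin n)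
    (wait : Fin n → ℕ → ℝ) (choice : Fin n → ℕ → Finset (Fin n) → Fin n) : ℝ≥0∞ :=
  ⨅ (τ : ℝ≥0) (_ : AllInformedBefore 𝒢 v₀ wait choice τ), (τ : ℝ≥0∞)

/-- The randomness of the asynchronous algorithm. Every node has an independent clock whose
ticks form a Poisson process of rate `1` (the waiting times are independent exponential variables
of rate `1`), and for every tick there is an independent choice which is uniform on `S` for each
nonempty `S`; only the choice for one `S`, the current set of neighbours, is ever used. -/
structure IsRandomClocks {n : ℕ} {Ω : Type*} [MeasurableSpace Ω] (μ : Measure Ω)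
    (wait : Fin n → ℕ → Ω → ℝ) (choice : Fin n → ℕ → Ω → Finset (Fin n) → Fin n) : Prop where
  measurable_wait : ∀ u k, Measurable (wait u k)
  measurable_choice : ∀ u k, Measurable (choice u k)
  wait_law : ∀ u k, μ.map (wait u k) = expMeasure 1
  choice_uniform : ∀ u k (S : Finset (Fin n)), ∀ v ∈ S,
    μ {ω | choice u k ω S = v} = ((S.card : ℝ≥0∞))⁻¹
  indep_wait_choice : ∀ u k, IndepFun (wait u k) (choice u k) μ
  indep_ticks : iIndepFun (fun (p : Fin n × ℕ) ω => (wait p.1 p.2 ω, choice p.1 p.2 ω)) μ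

end AsyncRumor

/-!
At an integer time `p` at which some node is uninformed and the exposed graph `G` is connected, some
edge `{u, v}` of `G` joins an informed and an uninformed node, and an endpoint of it, say `u`,
satisfies `1 / d_u ≥ ρ̄(G)` (`exists_cut_edge`). The clocks are memoryless, so that, whatever the
history up to time `p` is, the first tick of `u` from time `p` on comes before time `p + 1` with
probability `1 - 1/e`, and it independently goes to `v` with probability `1 / d_u`. Hence a new node
is informed during `[p, p + 1)` with conditional probability at least `(1 - 1/e) ρ̄(G)`
(`IsRandomClocks.measure_history_le_informed`). Although many nodes may become informed during one
time unit, this single contact suffices: the terms of the sum that defines `Tabs` add up to about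
`2 n`, and `2 (1 - 1/e) > 1`, so that in expectation more than `n` new nodes are available.

The deviation bound comes from the potential `(4/5) ^ |I_p| * exp (δ S_p)`, where `S_p` is the sum of
`⌈Φ(G)⌉ ρ̄(G)` over the graphs exposed before time `p` and `δ = (1 - 1/e) / 5`. It is a
supermartingale that starts below `1`, and if a node is uninformed at time `Tabs`, it has then reached
`(4/5) ^ n * exp (δ (2 n - 1))`, which is exponentially large in `n`; so this event has exponentially
small probability (`IsRandomClocks.measure_Tabs_lt_completionTime_le`). If all graphs are connected,
every term is at least `1 / n`, whence `Tabs ≤ 2 n ^ 2`.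

The conditional probability is computed (`IsRandomClocks.measure_history_le_contact`) by splitting
according to the number `k` of the first tick of `u` from time `p` on. Given `k`, the history up to
time `p` does not change if the ticks number `k, k + 1, …` of `u` are postponed (`history_delayed`),
so it is, on this event, determined by the remaining ticks, which are independent of tick number `k`
of `u`; Fubini's theorem then gives the claim (`measure_inter_tick_within_one`). No joint law beyond
this independence is needed, and no Poisson process has to be constructed.
-/

namespace AsyncRumor

/-! ### The run up to a time depends only on the ticks before that time -/

section Pathwise

variable {n : ℕ} {wait wait' : Fin n → ℕ → ℝ} {choice choice' : Fin n → ℕ → Finset (Fin n) → Fin n}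

/-- Two families of clocks that differ only in ticks at or after time `b` inform the same nodes up
to time `b`. -/
theorem InformedBefore.congr_of_ticks {G : SimpleGraph (Fin n)} {a b : ℝ} {I : Finset (Fin n)}
    (hloc : ∀ x k, (tick wait x k = tick wait' x k ∧ choice x k = choice' x k) ∨
      (b ≤ tick wait x k ∧ b ≤ tick wait' x k))
    {τ : ℝ} {v : Fin n} (h : InformedBefore wait choice G a I τ v) (hτ : τ ≤ b) :
    InformedBefore wait' choice' G a I τ v := by
  have contacts : ∀ {s x y}, s < b → Contacts wait choice G s x y →
      Contacts wait' choice' G s x y := by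
    rintro s x y hs ⟨k, hk, hadj, hc⟩
    rcases hloc x k with ⟨h1, h2⟩ | ⟨h1, -⟩
    · exact ⟨k, h1 ▸ hk, hadj, h2 ▸ hc⟩
    · linarith
  induction h with
  | init hv ha => exact .init hv ha
  | exchange _ hs hc ih =>
    exact .exchange (ih (hs.le.trans hτ)) hs
      (hc.imp (contacts (hs.trans_le hτ)) (contacts (hs.trans_le hτ)))

theorem history_congr_of_ticks (𝒢 : DynamicNetwork n) (v₀ : Fin n) {b : ℝ}
    (hloc : ∀ x k, (tick wait x k = tick wait' x k ∧ choice x k = choice' x k) ∨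
      (b ≤ tick wait x k ∧ b ≤ tick wait' x k)) (t : ℕ) (ht : (t : ℝ) ≤ b) :
    history 𝒢 v₀ wait choice t = history 𝒢 v₀ wait' choice' t := by
  induction t with
  | zero => rfl
  | succ t ih =>
    push_cast at ht
    rw [history, history, ih (by linarith)]
    congr 1
    ext v
    simp only [Finset.mem_filter, Finset.mem_univ, true_and]
    refine ⟨fun h => h.congr_of_ticks hloc ht, fun h => h.congr_of_ticks (fun x k => ?_) ht⟩
    exact (hloc x k).imp (fun h => ⟨h.1.symm, h.2.symm⟩) And.symm

theorem length_history (𝒢 : DynamicNetwork n) (v₀ : Fin n) (t : ℕ) :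
    (history 𝒢 v₀ wait choice t).length = t + 1 := by
  induction t with
  | zero => rfl
  | succ t ih => simp [history, ih]

/-- The set of nodes informed by the integer time `t`. -/
noncomputable def informedAt (𝒢 : DynamicNetwork n) (v₀ : Fin n) (wait : Fin n → ℕ → ℝ)
    (choice : Fin n → ℕ → Finset (Fin n) → Fin n) (t : ℕ) : Finset (Fin n) :=
  (history 𝒢 v₀ wait choice t).headD ∅

theorem mem_informedAt_succ {𝒢 : DynamicNetwork n} {v₀ : Fin n} {t : ℕ} {v : Fin n} :
    v ∈ informedAt 𝒢 v₀ wait choice (t + 1) ↔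
      InformedBefore wait choice (graphAt 𝒢 v₀ wait choice t) t
        (informedAt 𝒢 v₀ wait choice t) ((t : ℝ) + 1) v := by
  simp [informedAt, history, graphAt]

theorem informedAt_subset_succ (𝒢 : DynamicNetwork n) (v₀ : Fin n) (t : ℕ) :
    informedAt 𝒢 v₀ wait choice t ⊆ informedAt 𝒢 v₀ wait choice (t + 1) := fun _ hv =>
  mem_informedAt_succ.2 (.init hv (by linarith))

theorem informedAt_nonempty (𝒢 : DynamicNetwork n) (v₀ : Fin n) (t : ℕ) :
    (informedAt 𝒢 v₀ wait choice t).Nonempty := by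
  induction t with
  | zero => exact ⟨v₀, by simp [informedAt, history]⟩
  | succ t ih => exact ih.mono (informedAt_subset_succ 𝒢 v₀ t)

/-- A contact between an informed and an uninformed node during `[t, t + 1)`, in either direction,
informs a new node. -/
theorem card_informedAt_lt_succ {𝒢 : DynamicNetwork n} {v₀ : Fin n} {t : ℕ} {s : ℝ} {u v : Fin n}
    (hs : (t : ℝ) ≤ s) (hs' : s < (t : ℝ) + 1)
    (hc : Contacts wait choice (graphAt 𝒢 v₀ wait choice t) s u v)
    (huv : ¬(u ∈ informedAt 𝒢 v₀ wait choice t ↔ v ∈ informedAt 𝒢 v₀ wait choice t)) :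
    (informedAt 𝒢 v₀ wait choice t).card < (informedAt 𝒢 v₀ wait choice (t + 1)).card := by
  refine Finset.card_lt_card (Finset.ssubset_iff_subset_ne.2 ⟨informedAt_subset_succ 𝒢 v₀ t, ?_⟩)
  intro heq
  apply huv
  constructor
  · intro hu
    rw [heq]
    exact mem_informedAt_succ.2 (.exchange (.init hu hs) hs' (.inl hc))
  · intro hv
    rw [heq]
    exact mem_informedAt_succ.2 (.exchange (.init hv hs) hs' (.inr hc))

/-- If all nodes are informed by the integer time `t`, then the completion time is at most `t`. -/
theorem completionTime_le {𝒢 : DynamicNetwork n} {v₀ : Fin n} {t : ℕ}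
    (h : informedAt 𝒢 v₀ wait choice t = Finset.univ) :
    completionTime 𝒢 v₀ wait choice ≤ t := by
  refine iInf₂_le_of_le (t : ℝ≥0) (fun v => ?_) (by simp)
  have hv : v ∈ informedAt 𝒢 v₀ wait choice t := h ▸ Finset.mem_univ v
  have hfl : ⌊(t : ℝ≥0)⌋₊ = t := Nat.floor_natCast t
  rw [hfl]
  exact .init hv (by simp)

end Pathwise

/-! ### Measurability of the history -/

section Measurability

variable {n : ℕ}

open Classical in
/-- `v` is informed before time `τ` through a chain of at most `m` exchanges. -/
def InformedIn (wait : Fin n → ℕ → ℝ) (choice : Fin n → ℕ → Finset (Fin n) → Fin n)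
    (G : SimpleGraph (Fin n)) (a : ℝ) (I : Finset (Fin n)) : ℕ → ℝ → Fin n → Prop
  | 0, τ, v => v ∈ I ∧ a ≤ τ
  | m + 1, τ, v => InformedIn wait choice G a I m τ v ∨ ∃ (u : Fin n) (k : ℕ),
      (tick wait u k < τ ∧ InformedIn wait choice G a I m (tick wait u k) u ∧
        G.Adj u v ∧ choice u k (G.neighborFinset u) = v) ∨
      (tick wait v k < τ ∧ InformedIn wait choice G a I m (tick wait v k) u ∧
        G.Adj v u ∧ choice v k (G.neighborFinset v) = u)

theorem informedBefore_iff_exists_informedIn {wait : Fin n → ℕ → ℝ}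
    {choice : Fin n → ℕ → Finset (Fin n) → Fin n} {G : SimpleGraph (Fin n)} {a : ℝ}
    {I : Finset (Fin n)} {τ : ℝ} {v : Fin n} :
    InformedBefore wait choice G a I τ v ↔ ∃ m, InformedIn wait choice G a I m τ v := by
  constructor
  · intro h
    induction h with
    | init hv ha => exact ⟨0, hv, ha⟩
    | exchange _ hs hc ih =>
      obtain ⟨m, hm⟩ := ih
      rcases hc with ⟨k, rfl, hadj, hc⟩ | ⟨k, rfl, hadj, hc⟩
      · exact ⟨m + 1, .inr ⟨_, k, .inl ⟨hs, hm, hadj, hc⟩⟩⟩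
      · exact ⟨m + 1, .inr ⟨_, k, .inr ⟨hs, hm, hadj, hc⟩⟩⟩
  · rintro ⟨m, hm⟩
    induction m generalizing τ v with
    | zero => exact .init hm.1 hm.2
    | succ m ih =>
      rcases hm with hm | ⟨u, k, ⟨hs, hm, hadj, hc⟩ | ⟨hs, hm, hadj, hc⟩⟩
      · exact ih hm
      · exact .exchange (ih hm) hs (.inl ⟨k, rfl, hadj, hc⟩)
      · exact .exchange (ih hm) hs (.inr ⟨k, rfl, hadj, hc⟩)

variable {Ω : Type*} [MeasurableSpace Ω] {wait : Fin n → ℕ → Ω → ℝ}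
  {choice : Fin n → ℕ → Ω → Finset (Fin n) → Fin n}

theorem measurable_tick (hw : ∀ u k, Measurable (wait u k)) (u : Fin n) (k : ℕ) :
    Measurable fun ω => tick (fun u k => wait u k ω) u k :=
  Finset.measurable_sum _ fun i _ => hw u i

theorem measurableSet_choice_eq (hc : ∀ u k, Measurable (choice u k)) (u : Fin n) (k : ℕ)
    (S : Finset (Fin n)) (v : Fin n) : MeasurableSet {ω | choice u k ω S = v} :=
  ((measurable_pi_apply S).comp (hc u k)) (measurableSet_singleton v)

theorem measurableSet_informedBefore (hw : ∀ u k, Measurable (wait u k))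
    (hc : ∀ u k, Measurable (choice u k)) (G : SimpleGraph (Fin n)) (a : ℝ) (I : Finset (Fin n))
    (τ : ℝ) (v : Fin n) :
    MeasurableSet {ω | InformedBefore (fun u k => wait u k ω) (fun u k => choice u k ω)
      G a I τ v} := by
  have key : ∀ (m : ℕ) (τ : Ω → ℝ), Measurable τ → ∀ v, MeasurableSet {ω |
      InformedIn (fun u k => wait u k ω) (fun u k => choice u k ω) G a I m (τ ω) v} := by
    intro m
    induction m with
    | zero =>
      intro τ hτ v
      exact (MeasurableSet.const _).inter (measurableSet_le measurable_const hτ)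
    | succ m ih =>
      intro τ hτ v
      have hlt : ∀ u k, MeasurableSet {ω | tick (fun u k => wait u k ω) u k < τ ω} := fun u k =>
        measurableSet_lt (measurable_tick hw u k) hτ
      refine measurableSet_setOfPred.2 (.or (measurableSet_setOfPred.1 (ih τ hτ v))
        (.exists fun u => .exists fun k => measurableSet_setOfPred.1 (MeasurableSet.union ?_ ?_)))
      · exact (hlt u k).inter ((ih _ (measurable_tick hw u k) u).inter
          ((MeasurableSet.const _).inter (measurableSet_choice_eq hc _ _ _ _)))
      · exact (hlt v k).inter ((ih _ (measurable_tick hw v k) u).inter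
          ((MeasurableSet.const _).inter (measurableSet_choice_eq hc _ _ _ _)))
  simp only [informedBefore_iff_exists_informedIn, Set.ofPred_exists]
  exact MeasurableSet.iUnion fun m => key m _ measurable_const v

theorem measurableSet_history_eq (hw : ∀ u k, Measurable (wait u k))
    (hc : ∀ u k, Measurable (choice u k)) (𝒢 : DynamicNetwork n) (v₀ : Fin n) (t : ℕ)
    (h : List (Finset (Fin n))) :
    MeasurableSet {ω | history 𝒢 v₀ (fun u k => wait u k ω) (fun u k => choice u k ω) t = h} := by
  classical
  induction t generalizing h with
  | zero => exact MeasurableSet.const ([{v₀}] = h)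
  | succ t ih =>
    cases h with
    | nil => simp [history]
    | cons S h =>
      have : {ω | history 𝒢 v₀ (fun u k => wait u k ω) (fun u k => choice u k ω) (t + 1) = S :: h} =
          {ω | history 𝒢 v₀ (fun u k => wait u k ω) (fun u k => choice u k ω) t = h} ∩
          ⋂ v, {ω | v ∈ S ↔ InformedBefore (fun u k => wait u k ω) (fun u k => choice u k ω)
            (𝒢 t h) t (h.headD ∅) ((t : ℝ) + 1) v} := by
        ext ω
        simp only [history, List.cons.injEq, Set.mem_ofPred_eq, Set.mem_inter_iff, Set.mem_iInter]
        constructor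
        · rintro ⟨rfl, rfl⟩
          simp
        · rintro ⟨rfl, h2⟩
          refine ⟨?_, rfl⟩
          ext v
          simp [h2 v]
      rw [this]
      refine (ih h).inter (MeasurableSet.iInter fun v => ?_)
      exact (MeasurableSet.const _).iff (measurableSet_informedBefore hw hc _ _ _ _ v)

end Measurability

/-! ### Memorylessness of the exponential clock -/

section Exponential

theorem expMeasure_Iio {x : ℝ} (hx : 0 ≤ x) :
    expMeasure 1 (Set.Iio x) = ENNReal.ofReal (1 - Real.exp (-x)) := by
  have := isProbabilityMeasure_expMeasure one_pos
  have h0 : expMeasure 1 {x} = 0 :=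
    (withDensity_absolutelyContinuous volume (gammaPDF 1 1)) (measure_singleton x)
  have h1 : Set.Iic x = Set.Iio x ∪ {x} := by ext y; simp [le_iff_lt_or_eq]
  have h2 : expMeasure 1 (Set.Iio x) = expMeasure 1 (Set.Iic x) := by
    refine le_antisymm (measure_mono Set.Iio_subset_Iic_self) ?_
    rw [h1]
    exact (measure_union_le _ _).trans (by rw [h0, add_zero])
  rw [h2, ← ofReal_cdf, cdf_expMeasure_eq one_pos, if_pos hx, one_mul]

theorem expMeasure_Ici {x : ℝ} (hx : 0 ≤ x) :
    expMeasure 1 (Set.Ici x) = ENNReal.ofReal (Real.exp (-x)) := by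
  have := isProbabilityMeasure_expMeasure one_pos
  have h : Real.exp (-x) ≤ 1 := by simpa using hx
  rw [← Set.compl_Iio, prob_compl_eq_one_sub measurableSet_Iio, expMeasure_Iio hx,
    ← ENNReal.ofReal_one, ← ENNReal.ofReal_sub _ (by linarith), sub_sub_cancel]

/-- Given that the clock has not ticked before time `x`, it ticks during `[x, x + 1)` with
probability `1 - 1/e`. -/
theorem expMeasure_Ico {x : ℝ} (hx : 0 ≤ x) :
    expMeasure 1 (Set.Ico x (x + 1)) =
      ENNReal.ofReal (1 - Real.exp (-1)) * expMeasure 1 (Set.Ici x) := by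
  have := isProbabilityMeasure_expMeasure one_pos
  rw [← Set.Ici_sdiff_Ici, measure_sdiff (Set.Ici_subset_Ici.2 (by linarith))
    measurableSet_Ici.nullMeasurableSet (measure_ne_top _ _), expMeasure_Ici hx,
    expMeasure_Ici (by linarith), ← ENNReal.ofReal_sub _ (Real.exp_pos _).le,
    ← ENNReal.ofReal_mul (by simp)]
  congr 1
  rw [neg_add, Real.exp_add]
  ring

/-- The conditional form of memorylessness: the residual threshold `r` and the event `A` belong to
a σ-algebra that is independent of the waiting time `w` and of the mark `y` of the next tick. -/
theorem measure_inter_tick_within_one {Ω E : Type*} {m₁ mΩ : MeasurableSpace Ω}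
    [MeasurableSpace E] {μ : Measure Ω} [IsProbabilityMeasure μ] (hm : m₁ ≤ mΩ)
    {w r : Ω → ℝ} {y : Ω → E} (hw : Measurable w) (hy : Measurable y)
    (hind : Indep m₁ (MeasurableSpace.comap (fun ω => (w ω, y ω)) inferInstance) μ)
    (hwy : IndepFun w y μ) (hlaw : μ.map w = expMeasure 1) {A : Set Ω}
    (hA : MeasurableSet[m₁] A) (hr : Measurable[m₁] r) (hr0 : ∀ ω ∈ A, 0 ≤ r ω) {C : Set E}
    (hC : MeasurableSet C) :
    μ {ω | ω ∈ A ∧ r ω ≤ w ω ∧ w ω < r ω + 1 ∧ y ω ∈ C} =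
      ENNReal.ofReal (1 - Real.exp (-1)) * μ (y ⁻¹' C) * μ {ω | ω ∈ A ∧ r ω ≤ w ω} := by
  set X : Ω → Prop × ℝ := fun ω => (ω ∈ A, r ω)
  set Y : Ω → ℝ × E := fun ω => (w ω, y ω)
  have hX₁ : Measurable[m₁] X := 
    ((@measurableSet_setOfPred Ω m₁ (fun ω => ω ∈ A)).1 hA).prodMk hr
  have hX : Measurable X := hX₁.mono hm le_rfl
  have hY : Measurable Y := hw.prodMk hy
  have hXY : IndepFun X Y μ := indep_of_indep_of_le_left hind hX₁.comap_le
  have := isProbabilityMeasure_expMeasure one_pos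
  have := Measure.isProbabilityMeasure_map (μ := μ) hX.aemeasurable
  have := Measure.isProbabilityMeasure_map (μ := μ) hY.aemeasurable
  have := Measure.isProbabilityMeasure_map (μ := μ) hy.aemeasurable
  have hmap := hXY.map_prod_eq_prod_map_map hX.aemeasurable hY.aemeasurable
  have hmapY : μ.map Y = (expMeasure 1).prod (μ.map y) := by
    rw [← hlaw]
    exact hwy.map_prod_eq_prod_map_map hw.aemeasurable hy.aemeasurable
  set B : Set ((Prop × ℝ) × (ℝ × E)) :=
    {q | q.1.1 ∧ 0 ≤ q.1.2 ∧ q.1.2 ≤ q.2.1 ∧ q.2.1 < q.1.2 + 1 ∧ q.2.2 ∈ C}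
  set B' : Set ((Prop × ℝ) × (ℝ × E)) := {q | q.1.1 ∧ 0 ≤ q.1.2 ∧ q.1.2 ≤ q.2.1}
  have hp : MeasurableSet {q : (Prop × ℝ) × (ℝ × E) | q.1.1} :=
    measurableSet_setOfPred.2 (measurable_fst.comp measurable_fst)
  have h1 : Measurable fun q : (Prop × ℝ) × (ℝ × E) => q.1.2 := by fun_prop
  have h2 : Measurable fun q : (Prop × ℝ) × (ℝ × E) => q.2.1 := by fun_prop
  have h3 : Measurable fun q : (Prop × ℝ) × (ℝ × E) => q.2.2 := by fun_prop
  have hB : MeasurableSet B :=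
    hp.inter ((measurableSet_le measurable_const h1).inter ((measurableSet_le h1 h2).inter
      ((measurableSet_lt h2 (h1.add_const 1)).inter (h3 hC))))
  have hB' : MeasurableSet B' :=
    hp.inter ((measurableSet_le measurable_const h1).inter (measurableSet_le h1 h2))
  have e1 : {ω | ω ∈ A ∧ r ω ≤ w ω ∧ w ω < r ω + 1 ∧ y ω ∈ C} = (fun ω => (X ω, Y ω)) ⁻¹' B := by
    ext ω
    exact ⟨fun h => ⟨h.1, hr0 ω h.1, h.2⟩, fun h => ⟨h.1, h.2.2⟩⟩
  have e2 : {ω | ω ∈ A ∧ r ω ≤ w ω} = (fun ω => (X ω, Y ω)) ⁻¹' B' := by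
    ext ω
    exact ⟨fun h => ⟨h.1, hr0 ω h.1, h.2⟩, fun h => ⟨h.1, h.2.2⟩⟩
  rw [e1, e2, ← Measure.map_apply (hX.prodMk hY) hB, ← Measure.map_apply (hX.prodMk hY) hB', hmap,
    Measure.prod_apply hB, Measure.prod_apply hB', ← lintegral_const_mul _
      (measurable_measure_prodMk_left hB')]
  refine lintegral_congr fun x => ?_
  by_cases hx : x.1 ∧ 0 ≤ x.2
  · have s1 : Prod.mk x ⁻¹' B = Set.Ico x.2 (x.2 + 1) ×ˢ C := by
      ext q
      simp [B, hx.1, hx.2, and_assoc]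
    have s2 : Prod.mk x ⁻¹' B' = Set.Ici x.2 ×ˢ Set.univ := by
      ext q
      simp [B', hx.1, hx.2]
    rw [s1, s2, hmapY, Measure.prod_prod, Measure.prod_prod, expMeasure_Ico hx.2,
      Measure.map_apply hy hC, measure_univ]
    ring
  · have s1 : Prod.mk x ⁻¹' B = ∅ := Set.eq_empty_of_forall_notMem fun q h => hx ⟨h.1, h.2.1⟩
    have s2 : Prod.mk x ⁻¹' B' = ∅ := Set.eq_empty_of_forall_notMem fun q h => hx ⟨h.1, h.2.1⟩
    simp [s1, s2]

end Exponential

/-! ### Almost sure properties of the clocks -/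

section Clocks

variable {n : ℕ} {Ω : Type*} [MeasurableSpace Ω] {μ : Measure Ω}
  {wait : Fin n → ℕ → Ω → ℝ} {choice : Fin n → ℕ → Ω → Finset (Fin n) → Fin n}

theorem IsRandomClocks.ae_wait_nonneg (h : IsRandomClocks μ wait choice) :
    ∀ᵐ ω ∂μ, ∀ u k, 0 ≤ wait u k ω := by
  refine ae_all_iff.2 fun u => ae_all_iff.2 fun k => ?_
  have h0 : μ (wait u k ⁻¹' Set.Iio 0) = 0 := by
    rw [← Measure.map_apply (h.measurable_wait u k) measurableSet_Iio, h.wait_law,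
      expMeasure_Iio le_rfl]
    simp
  filter_upwards [measure_eq_zero_iff_ae_notMem.1 h0] with ω hω
  simpa using hω

/-- Almost surely some waiting time of `u` is at least `p`, so that the clock of `u` passes time `p`
after finitely many ticks. -/
theorem IsRandomClocks.ae_exists_le_wait (h : IsRandomClocks μ wait choice) (u : Fin n) {p : ℝ}
    (hp : 0 ≤ p) : ∀ᵐ ω ∂μ, ∃ k, p ≤ wait u k ω := by
  have hmeas : MeasurableSet (Prod.fst ⁻¹' Set.Iio p : Set (ℝ × (Finset (Fin n) → Fin n))) :=
    measurable_fst measurableSet_Iio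
  have hbound : ∀ K : ℕ, μ {ω | ∀ k, wait u k ω < p} ≤
      ENNReal.ofReal (1 - Real.exp (-p)) ^ K := by
    intro K
    classical
    have hK := h.indep_ticks.measure_inter_preimage_eq_mul
      ((Finset.range K).map ⟨fun k => (u, k), fun _ _ e => (Prod.ext_iff.1 e).2⟩)
      (sets := fun _ => Prod.fst ⁻¹' Set.Iio p) (fun _ _ => hmeas)
    rw [Finset.prod_map] at hK
    have hfac : ∀ k, μ ((fun ω => (wait u k ω, choice u k ω)) ⁻¹' (Prod.fst ⁻¹' Set.Iio p)) =
        ENNReal.ofReal (1 - Real.exp (-p)) := by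
      intro k
      rw [← expMeasure_Iio hp, ← h.wait_law u k,
        Measure.map_apply (h.measurable_wait u k) measurableSet_Iio]
      rfl
    replace hK := hK.trans (Finset.prod_congr rfl fun k _ => hfac k)
    rw [Finset.prod_const, Finset.card_range] at hK
    rw [← hK]
    refine measure_mono fun ω hω => Set.mem_iInter₂.2 ?_
    rintro ⟨x, k⟩ hq
    obtain ⟨j, -, hj⟩ := Finset.mem_map.1 hq
    obtain ⟨rfl, rfl⟩ := Prod.ext_iff.1 hj
    exact hω _
  have hlim := ENNReal.tendsto_pow_atTop_nhds_zero_of_lt_one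
    (show ENNReal.ofReal (1 - Real.exp (-p)) < 1 by
      rw [ENNReal.ofReal_lt_one]
      linarith [Real.exp_pos (-p)])
  have h0 : μ {ω | ∀ k, wait u k ω < p} = 0 :=
    le_antisymm (ge_of_tendsto' hlim hbound) zero_le
  filter_upwards [measure_eq_zero_iff_ae_notMem.1 h0] with ω hω
  simpa using hω

end Clocks

/-! ### A fixed contact happens within one time unit -/

section Contact

variable {n : ℕ} {Ω : Type*}

/-- The σ-algebra generated by all ticks except for the ticks number `k, k + 1, …` of `u`. -/
abbrev othersAlgebra (wait : Fin n → ℕ → Ω → ℝ) (choice : Fin n → ℕ → Ω → Finset (Fin n) → Fin n)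
    (u : Fin n) (k : ℕ) : MeasurableSpace Ω :=
  ⨆ q ∈ {q : Fin n × ℕ | ¬(q.1 = u ∧ k ≤ q.2)},
    MeasurableSpace.comap (fun ω => (wait q.1 q.2 ω, choice q.1 q.2 ω)) inferInstance

theorem measurable_pair_othersAlgebra {wait : Fin n → ℕ → Ω → ℝ}
    {choice : Fin n → ℕ → Ω → Finset (Fin n) → Fin n} {u x : Fin n} {k j : ℕ}
    (h : ¬(x = u ∧ k ≤ j)) :
    Measurable[othersAlgebra wait choice u k] fun ω => (wait x j ω, choice x j ω) :=
  measurable_iff_comap_le.2 (le_iSup₂_of_le (x, j) h le_rfl)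

/-- The clocks in which the waiting times number `k, k + 1, …` of `u` are replaced by `p`, which
postpones these ticks to time `p` or later. -/
def delayedWait (wait : Fin n → ℕ → Ω → ℝ) (u : Fin n) (k : ℕ) (p : ℝ) :
    Fin n → ℕ → Ω → ℝ :=
  fun x j ω => if x = u ∧ k ≤ j then p else wait x j ω

/-- The contacts in which the choices number `k, k + 1, …` of `u` are replaced by a constant. -/
def delayedChoice (choice : Fin n → ℕ → Ω → Finset (Fin n) → Fin n) (u : Fin n) (k : ℕ) :
    Fin n → ℕ → Ω → Finset (Fin n) → Fin n :=
  fun x j ω => if x = u ∧ k ≤ j then fun _ => u else choice x j ω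

theorem measurable_delayedWait (wait : Fin n → ℕ → Ω → ℝ)
    (choice : Fin n → ℕ → Ω → Finset (Fin n) → Fin n) (u : Fin n) (k : ℕ) (p : ℝ) (x : Fin n)
    (j : ℕ) : Measurable[othersAlgebra wait choice u k] (delayedWait wait u k p x j) := by
  by_cases h : x = u ∧ k ≤ j
  · have : delayedWait wait u k p x j = fun _ => p := by ext; simp [delayedWait, h]
    rw [this]
    exact @measurable_const _ _ _ (othersAlgebra wait choice u k) _
  · have : delayedWait wait u k p x j = wait x j := by ext; simp [delayedWait, h]
    rw [this]
    exact measurable_fst.comp (measurable_pair_othersAlgebra h)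

theorem measurable_delayedChoice (wait : Fin n → ℕ → Ω → ℝ)
    (choice : Fin n → ℕ → Ω → Finset (Fin n) → Fin n) (u : Fin n) (k : ℕ) (x : Fin n)
    (j : ℕ) : Measurable[othersAlgebra wait choice u k] (delayedChoice choice u k x j) := by
  by_cases h : x = u ∧ k ≤ j
  · have : delayedChoice choice u k x j = fun _ _ => u := by ext; simp [delayedChoice, h]
    rw [this]
    exact @measurable_const _ _ _ (othersAlgebra wait choice u k) _
  · have : delayedChoice choice u k x j = choice x j := by ext; simp [delayedChoice, h]
    rw [this]
    exact measurable_snd.comp (measurable_pair_othersAlgebra h)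

/-- If tick number `k` of `u` is at or after time `p`, then the history up to time `p` does not see
the ticks number `k, k + 1, …` of `u`. -/
theorem history_delayed (𝒢 : DynamicNetwork n) (v₀ : Fin n) {wait : Fin n → ℕ → Ω → ℝ}
    (choice : Fin n → ℕ → Ω → Finset (Fin n) → Fin n) {u : Fin n} {k p : ℕ} {ω : Ω}
    (h0 : ∀ x j, 0 ≤ wait x j ω) (hk : (p : ℝ) ≤ tick (fun u k => wait u k ω) u k) :
    history 𝒢 v₀ (fun x j => delayedWait wait u k p x j ω)
        (fun x j => delayedChoice choice u k x j ω) p =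
      history 𝒢 v₀ (fun x j => wait x j ω) (fun x j => choice x j ω) p := by
  refine history_congr_of_ticks 𝒢 v₀ (fun x j => ?_) p le_rfl
  by_cases h : x = u ∧ k ≤ j
  · right
    obtain ⟨rfl, hj⟩ := h
    constructor
    · have hle := Finset.single_le_sum (f := fun i => delayedWait wait x k p x i ω)
        (s := Finset.range (j + 1)) (fun i _ => by
          simp only [delayedWait]
          split_ifs
          · exact p.cast_nonneg
          · exact h0 _ _) (Finset.self_mem_range_succ j)
      simpa [delayedWait, hj, tick] using hle
    · refine hk.trans (Finset.sum_le_sum_of_subset_of_nonneg ?_ fun i _ _ => h0 _ _)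
      exact Finset.range_subset_range.2 (by omega)
  · left
    refine ⟨Finset.sum_congr rfl fun i hi => ?_, by simp [delayedChoice, h]⟩
    have hi' : ¬(x = u ∧ k ≤ i) := fun hh => h ⟨hh.1, by
      have := Finset.mem_range.1 hi
      omega⟩
    simp [delayedWait, hi']

variable [MeasurableSpace Ω] {μ : Measure Ω} {wait : Fin n → ℕ → Ω → ℝ}
  {choice : Fin n → ℕ → Ω → Finset (Fin n) → Fin n}

theorem IsRandomClocks.othersAlgebra_le (h : IsRandomClocks μ wait choice) (u : Fin n) (k : ℕ) :
    othersAlgebra wait choice u k ≤ ‹MeasurableSpace Ω› :=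
  iSup₂_le fun q _ => ((h.measurable_wait q.1 q.2).prodMk (h.measurable_choice q.1 q.2)).comap_le

theorem IsRandomClocks.indep_othersAlgebra (h : IsRandomClocks μ wait choice) (u : Fin n) (k : ℕ) :
    Indep (othersAlgebra wait choice u k)
      (MeasurableSpace.comap (fun ω => (wait u k ω, choice u k ω)) inferInstance) μ := by
  have hdisj : Disjoint {q : Fin n × ℕ | ¬(q.1 = u ∧ k ≤ q.2)} {(u, k)} := by simp
  have := indep_iSup_of_disjoint
    (fun q => ((h.measurable_wait q.1 q.2).prodMk (h.measurable_choice q.1 q.2)).comap_le)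
    h.indep_ticks.iIndep hdisj
  simpa [othersAlgebra] using this

open Classical in
/-- Given the history up to time `p`, the first tick of `u` from time `p` on takes place before time
`p + 1` and goes to the neighbour `v` with probability at least `(1 - 1/e) / d_u`. The proof
distinguishes the number `k` of that tick. -/
theorem IsRandomClocks.measure_history_le_contact [IsProbabilityMeasure μ]
    (h : IsRandomClocks μ wait choice) (𝒢 : DynamicNetwork n) (v₀ : Fin n) (p : ℕ)
    (H : List (Finset (Fin n))) (G : SimpleGraph (Fin n)) {u v : Fin n} (huv : G.Adj u v) :
    ENNReal.ofReal (1 - Real.exp (-1)) * (G.degree u : ℝ≥0∞)⁻¹ *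
        μ {ω | history 𝒢 v₀ (fun u k => wait u k ω) (fun u k => choice u k ω) p = H} ≤
      μ {ω | history 𝒢 v₀ (fun u k => wait u k ω) (fun u k => choice u k ω) p = H ∧
        ∃ s : ℝ, (p : ℝ) ≤ s ∧ s < (p : ℝ) + 1 ∧
          Contacts (fun u k => wait u k ω) (fun u k => choice u k ω) G s u v} := by
  set T : ℕ → Ω → ℝ := fun k ω => tick (fun u k => wait u k ω) u k
  set A : ℕ → Set Ω := fun k => {ω | history 𝒢 v₀ (fun x j => delayedWait wait u k p x j ω)
    (fun x j => delayedChoice choice u k x j ω) p = H ∧ ∀ j < k, T j ω < p}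
  set r : ℕ → Ω → ℝ := fun k ω => p - ∑ i ∈ Finset.range k, wait u i ω
  have hrT : ∀ k ω, r k ω ≤ wait u k ω ↔ (p : ℝ) ≤ T k ω := by
    intro k ω
    simp only [r, T, tick, Finset.sum_range_succ]
    exact sub_le_iff_le_add'
  have hrT' : ∀ k ω, wait u k ω < r k ω + 1 ↔ T k ω < p + 1 := by
    intro k ω
    simp only [r, T, tick, Finset.sum_range_succ]
    constructor <;> intro <;> linarith
  have hsum : ∀ k, ∀ i < k, Measurable[othersAlgebra wait choice u k] (wait u i) := fun k i hi =>
    measurable_fst.comp (measurable_pair_othersAlgebra (u := u) (x := u) (k := k) (j := i)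
      (by omega))
  have hA : ∀ k, MeasurableSet[othersAlgebra wait choice u k] (A k) := by
    intro k
    suffices hS : MeasurableSet[othersAlgebra wait choice u k] {ω | ∀ j < k, T j ω < p} from
      @MeasurableSet.inter _ (othersAlgebra wait choice u k) _ _
        (@measurableSet_history_eq _ _ (othersAlgebra wait choice u k) _ _
          (measurable_delayedWait wait choice u k p) (measurable_delayedChoice wait choice u k)
          𝒢 v₀ p H) hS
    have : {ω | ∀ j < k, T j ω < p} = ⋂ j, ⋂ (_ : j < k), {ω | T j ω < p} := by ext; simp
    rw [this]
    refine @MeasurableSet.iInter _ _ (othersAlgebra wait choice u k) _ _ fun j =>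
      @MeasurableSet.iInter _ _ (othersAlgebra wait choice u k) _ _ fun hj => ?_
    have hT : Measurable[othersAlgebra wait choice u k] (T j) :=
      @Finset.measurable_sum _ _ _ _ _ _ (othersAlgebra wait choice u k) _ _ fun i hi =>
        hsum k i (by have := Finset.mem_range.1 hi; omega)
    exact hT measurableSet_Iio
  have hr : ∀ k, Measurable[othersAlgebra wait choice u k] (r k) := fun k =>
    Measurable.const_sub (@Finset.measurable_sum _ _ _ _ _ _ (othersAlgebra wait choice u k) _ _
      fun i hi => hsum k i (Finset.mem_range.1 hi)) _
  have hr0 : ∀ k, ∀ ω ∈ A k, 0 ≤ r k ω := by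
    intro k ω hω
    rcases k with _ | k
    · simp [r]
    · exact sub_nonneg.2 (hω.2 k (Nat.lt_succ_self k)).le
  set E : ℕ → Set Ω := fun k => {ω | ω ∈ A k ∧ r k ω ≤ wait u k ω}
  set F : ℕ → Set Ω := fun k => {ω | ω ∈ A k ∧ r k ω ≤ wait u k ω ∧ wait u k ω < r k ω + 1 ∧
    choice u k ω ∈ {f | f (G.neighborFinset u) = v}}
  have hC : MeasurableSet {f : Finset (Fin n) → Fin n | f (G.neighborFinset u) = v} :=
    (measurable_pi_apply (X := fun _ : Finset (Fin n) => Fin n) (G.neighborFinset u))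
      (measurableSet_singleton v)
  have hF : ∀ k, μ (F k) =
      ENNReal.ofReal (1 - Real.exp (-1)) * (G.degree u : ℝ≥0∞)⁻¹ * μ (E k) := by
    intro k
    rw [measure_inter_tick_within_one (h.othersAlgebra_le u k) (h.measurable_wait u k)
      (h.measurable_choice u k) (h.indep_othersAlgebra u k) (h.indep_wait_choice u k)
      (h.wait_law u k) (hA k) (hr k) (hr0 k) hC]
    congr 2
    exact h.choice_uniform u k _ v (by simpa using huv)
  have hdisj : Pairwise (Function.onFun Disjoint E) := by
    intro i j hij
    wlog hlt : i < j generalizing i j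
    · exact (this hij.symm (by omega)).symm
    · refine Set.disjoint_left.2 fun ω hi hj => ?_
      have h1 := (hrT i ω).1 hi.2
      have h2 := hj.1.2 i hlt
      exact absurd h1 (not_le.2 h2)
  have hFE : ∀ k, F k ⊆ E k := fun k ω hω => ⟨hω.1, hω.2.1⟩
  have hAm : ∀ k, MeasurableSet (A k) := fun k => h.othersAlgebra_le u k _ (hA k)
  have hrm : ∀ k, Measurable (r k) := fun k => (hr k).mono (h.othersAlgebra_le u k) le_rfl
  have hE : ∀ k, MeasurableSet (E k) := fun k =>
    (hAm k).inter (measurableSet_le (hrm k) (h.measurable_wait u k))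
  have hFm : ∀ k, MeasurableSet (F k) := fun k =>
    (hAm k).inter ((measurableSet_le (hrm k) (h.measurable_wait u k)).inter
      ((measurableSet_lt (h.measurable_wait u k) ((hrm k).add_const 1)).inter
        (h.measurable_choice u k hC)))
  calc _ ≤ ENNReal.ofReal (1 - Real.exp (-1)) * (G.degree u : ℝ≥0∞)⁻¹ * μ (⋃ k, E k) := by
        refine mul_le_mul le_rfl (measure_mono_ae ?_) zero_le zero_le
        filter_upwards [h.ae_wait_nonneg, h.ae_exists_le_wait u p.cast_nonneg] with ω h0 ⟨k, hk⟩ hω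
        have hex : ∃ k, (p : ℝ) ≤ T k ω := ⟨k, hk.trans (Finset.single_le_sum
          (f := fun i => wait u i ω) (fun i _ => h0 u i) (Finset.self_mem_range_succ k))⟩
        refine Set.mem_iUnion.2 ⟨Nat.find hex, ⟨?_, fun j hj => ?_⟩, (hrT _ _).2 (Nat.find_spec hex)⟩
        · exact (history_delayed 𝒢 v₀ choice h0 (Nat.find_spec hex)).trans hω
        · exact not_le.1 (Nat.find_min hex hj)
    _ = μ (⋃ k, F k) := by
        rw [measure_iUnion hdisj hE, measure_iUnion (fun i j hij =>
          (hdisj hij).mono (hFE i) (hFE j)) hFm, ← ENNReal.tsum_mul_left]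
        exact tsum_congr fun k => (hF k).symm
    _ ≤ _ := by
        refine measure_mono_ae ?_
        filter_upwards [h.ae_wait_nonneg] with ω h0 hω
        obtain ⟨k, hAk, h1, h2, h3⟩ := Set.mem_iUnion.1 hω
        have hpT := (hrT k ω).1 h1
        exact ⟨(history_delayed 𝒢 v₀ choice h0 hpT).symm.trans hAk.1, T k ω, hpT,
          (hrT' k ω).1 h2, k, rfl, huv, h3⟩

end Contact

/-! ### The progress guaranteed by a graph -/

section Graph

variable {n : ℕ}

open Classical in
theorem absDiligence_le_of_adj {G : SimpleGraph (Fin n)} {u v : Fin n} (h : G.Adj u v) :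
    absDiligence G ≤ max (1 / (G.degree u : ℝ)) (1 / (G.degree v : ℝ)) := by
  refine csInf_le ⟨0, ?_⟩ ⟨u, v, h, rfl⟩
  rintro x ⟨u, v, -, rfl⟩
  positivity

theorem absDiligence_nonneg (G : SimpleGraph (Fin n)) : 0 ≤ absDiligence G := by
  refine Real.sInf_nonneg ?_
  rintro x ⟨u, v, -, rfl⟩
  positivity

theorem absDiligence_le_one (G : SimpleGraph (Fin n)) : absDiligence G ≤ 1 := by
  classical
  by_cases h : ∃ u v, G.Adj u v
  · obtain ⟨u, v, h⟩ := h
    refine (absDiligence_le_of_adj h).trans (max_le ?_ ?_) <;>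
    · rw [one_div]
      exact Nat.cast_inv_le_one _
  · have : absDiligence G = 0 := by
      unfold absDiligence
      convert Real.sInf_empty using 2
      exact Set.eq_empty_of_forall_notMem fun x ⟨u, v, huv, _⟩ => h ⟨u, v, huv⟩
    rw [this]
    exact zero_le_one

theorem inv_le_absDiligence_of_connected {G : SimpleGraph (Fin n)} (hG : G.Connected)
    (hn : 2 ≤ n) : (n : ℝ)⁻¹ ≤ absDiligence G := by
  classical
  have : Nontrivial (Fin n) := Fin.nontrivial_iff_two_le.2 hn
  obtain ⟨v, hv⟩ := hG.preconnected.exists_adj_of_nontrivial ⟨0, by omega⟩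
  refine le_csInf ⟨_, _, _, hv, rfl⟩ ?_
  rintro x ⟨u, w, huw, rfl⟩
  refine le_max_of_le_left ?_
  rw [one_div]
  have hd : 0 < G.degree u := (G.degree_pos_iff_exists_adj u).2 ⟨w, huw⟩
  have hd' : G.degree u ≤ n := by simpa using (G.degree_lt_card_verts u).le
  gcongr

/-- The amount `⌈Φ(G)⌉ · ρ̄(G)` that the graph `G` contributes to the sum defining `Tabs`. -/
noncomputable def progress (G : SimpleGraph (Fin n)) : ℝ :=
  ceilConductance G * absDiligence G

theorem progress_nonneg (G : SimpleGraph (Fin n)) : 0 ≤ progress G := by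
  unfold progress ceilConductance
  split_ifs
  · simpa using absDiligence_nonneg G
  · simp

theorem progress_le_one (G : SimpleGraph (Fin n)) : progress G ≤ 1 := by
  unfold progress ceilConductance
  split_ifs
  · simpa using absDiligence_le_one G
  · simp

theorem inv_le_progress_of_connected {G : SimpleGraph (Fin n)} (hG : G.Connected)
    (hn : 2 ≤ n) : (n : ℝ)⁻¹ ≤ progress G := by
  simpa [progress, ceilConductance, hG] using inv_le_absDiligence_of_connected hG hn

open Classical in
/-- Every cut of a connected graph is crossed by an edge with an endpoint whose inverse degree is at
least the absolute diligence. -/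
theorem exists_cut_edge {G : SimpleGraph (Fin n)} (hG : G.Connected) {I : Finset (Fin n)}
    (hne : I.Nonempty) (huniv : I ≠ Finset.univ) :
    ∃ u v, G.Adj u v ∧ ¬(u ∈ I ↔ v ∈ I) ∧ absDiligence G ≤ (G.degree u : ℝ)⁻¹ := by
  obtain ⟨a, ha⟩ := hne
  obtain ⟨b, hb⟩ : ∃ b, b ∉ I := by simpa [Finset.eq_univ_iff_forall] using huniv
  obtain ⟨w⟩ := hG.preconnected a b
  obtain ⟨d, -, h1, h2⟩ := w.exists_boundary_dart (I : Set (Fin n)) ha hb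
  have h1' : d.fst ∈ I := h1
  have h2' : d.snd ∉ I := h2
  have hle := absDiligence_le_of_adj d.adj
  rw [one_div, one_div] at hle
  rcases le_max_iff.1 hle with h | h
  · exact ⟨_, _, d.adj, by simp [h1', h2'], h⟩
  · exact ⟨_, _, d.adj.symm, by simp [h1', h2'], h⟩

/-- The sum of the `progress` of the graphs exposed up to the time at which the history is `H`. -/
noncomputable def totalProgress (𝒢 : DynamicNetwork n) : List (Finset (Fin n)) → ℝ
  | [] => 0
  | I :: H => totalProgress 𝒢 H + progress (𝒢 H.length (I :: H))

theorem totalProgress_history (𝒢 : DynamicNetwork n) (v₀ : Fin n) (wait : Fin n → ℕ → ℝ)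
    (choice : Fin n → ℕ → Finset (Fin n) → Fin n) (t : ℕ) :
    totalProgress 𝒢 (history 𝒢 v₀ wait choice t) =
      ∑ q ∈ Finset.range (t + 1), progress (graphAt 𝒢 v₀ wait choice q) := by
  induction t with
  | zero => simp [history, totalProgress, graphAt]
  | succ t ih =>
    rw [Finset.sum_range_succ, ← ih, graphAt, history, totalProgress, length_history]

end Graph

/-! ### The exponential supermartingale -/

section Supermartingale

variable {n : ℕ}

/-- The exponent by which a unit of progress is rewarded in `potential`. -/
noncomputable def rewardRate : ℝ := (1 - Real.exp (-1)) / 5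

theorem rewardRate_pos : 0 < rewardRate := by
  have : Real.exp (-1) < 1 := by simp
  unfold rewardRate
  linarith

open Classical in
/-- The potential at time `t`, which is `(4/5) ^ |I_t|`, multiplied by `exp (rewardRate * S_t)` where
`S_t` is the progress of the graphs before time `t`. It is set to `0` once `S_t ≥ 2 * n` or all nodes
are informed. -/
noncomputable def potential (𝒢 : DynamicNetwork n) (v₀ : Fin n) (wait : Fin n → ℕ → ℝ)
    (choice : Fin n → ℕ → Finset (Fin n) → Fin n) (t : ℕ) : ℝ :=
  if ∑ q ∈ Finset.range t, progress (graphAt 𝒢 v₀ wait choice q) < 2 * n ∧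
      informedAt 𝒢 v₀ wait choice t ≠ Finset.univ then
    (4 / 5) ^ (informedAt 𝒢 v₀ wait choice t).card *
      Real.exp (rewardRate * ∑ q ∈ Finset.range t, progress (graphAt 𝒢 v₀ wait choice q))
  else 0

/-- The threshold `2 * n` is reached by the graph exposed at time `t` while some node is
uninformed. -/
def LateAt (𝒢 : DynamicNetwork n) (v₀ : Fin n) (wait : Fin n → ℕ → ℝ)
    (choice : Fin n → ℕ → Finset (Fin n) → Fin n) (t : ℕ) : Prop :=
  ∑ q ∈ Finset.range t, progress (graphAt 𝒢 v₀ wait choice q) < 2 * n ∧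
    2 * n ≤ ∑ q ∈ Finset.range (t + 1), progress (graphAt 𝒢 v₀ wait choice q) ∧
    informedAt 𝒢 v₀ wait choice t ≠ Finset.univ

/-- A lower bound for the potential at the time `Tabs`, if some node is still uninformed then. -/
noncomputable def latePotential (n : ℕ) : ℝ :=
  (4 / 5) ^ n * Real.exp (rewardRate * (2 * n - 1))

theorem latePotential_pos (n : ℕ) : 0 < latePotential n := by
  unfold latePotential
  positivity

section Pathwise

variable {𝒢 : DynamicNetwork n} {v₀ : Fin n} {wait : Fin n → ℕ → ℝ}
    {choice : Fin n → ℕ → Finset (Fin n) → Fin n}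

theorem potential_zero_le_one : potential 𝒢 v₀ wait choice 0 ≤ 1 := by
  unfold potential
  split_ifs
  · simpa using pow_le_one₀ (by norm_num) (by norm_num)
  · exact zero_le_one

theorem LateAt.latePotential_le {t : ℕ} (h : LateAt 𝒢 v₀ wait choice t) :
    latePotential n ≤ potential 𝒢 v₀ wait choice t := by
  obtain ⟨h1, h2, h3⟩ := h
  rw [Finset.sum_range_succ] at h2
  have h4 := progress_le_one (graphAt 𝒢 v₀ wait choice t)
  rw [potential, if_pos ⟨h1, h3⟩, latePotential]
  have hcard : (informedAt 𝒢 v₀ wait choice t).card ≤ n := by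
    simpa using Finset.card_le_univ (informedAt 𝒢 v₀ wait choice t)
  refine mul_le_mul (pow_le_pow_of_le_one (by norm_num) (by norm_num) hcard) ?_
    (by positivity) (by positivity)
  refine Real.exp_le_exp.2 (mul_le_mul_of_nonneg_left ?_ rewardRate_pos.le)
  linarith

theorem potential_succ_eq_zero {t : ℕ} (h : 2 * n ≤ ∑ q ∈ Finset.range (t + 1),
      progress (graphAt 𝒢 v₀ wait choice q) ∨ informedAt 𝒢 v₀ wait choice t = Finset.univ) :
    potential 𝒢 v₀ wait choice (t + 1) = 0 := by
  refine if_neg fun h' => ?_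
  rcases h with h | h
  · exact absurd h'.1 (not_lt.2 h)
  · exact h'.2 (Finset.univ_subset_iff.1 (h ▸ informedAt_subset_succ 𝒢 v₀ t))

/-- The potential grows at most by the reward, and loses the factor `4 / 5` if a new node is
informed. -/
theorem potential_succ_le {t : ℕ} (h : informedAt 𝒢 v₀ wait choice t ≠ Finset.univ)
    (h' : ∑ q ∈ Finset.range t, progress (graphAt 𝒢 v₀ wait choice q) < 2 * n) :
    potential 𝒢 v₀ wait choice (t + 1) ≤ potential 𝒢 v₀ wait choice t *
      Real.exp (rewardRate * progress (graphAt 𝒢 v₀ wait choice t)) *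
      (if (informedAt 𝒢 v₀ wait choice t).card < (informedAt 𝒢 v₀ wait choice (t + 1)).card
        then 4 / 5 else 1) := by
  have h0 : potential 𝒢 v₀ wait choice t = _ := if_pos ⟨h', h⟩
  rw [h0, potential]
  split_ifs with h1 h2 h2
  · rw [Finset.sum_range_succ, mul_add, Real.exp_add]
    calc _ ≤ (4 / 5 : ℝ) ^ ((informedAt 𝒢 v₀ wait choice t).card + 1) * _ :=
        mul_le_mul_of_nonneg_right (pow_le_pow_of_le_one (by norm_num) (by norm_num) h2)
          (by positivity)
      _ = _ := by ring
  · rw [Finset.sum_range_succ, mul_add, Real.exp_add, mul_one, mul_assoc]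
    exact mul_le_mul_of_nonneg_right (pow_le_pow_of_le_one (by norm_num) (by norm_num)
      (Finset.card_le_card (informedAt_subset_succ 𝒢 v₀ t))) (by positivity)
  · positivity
  · positivity

/-- If no time is late, then all nodes are informed by time `Tabs`. -/
theorem completionTime_le_Tabs (hn : 0 < n) (h : ∀ t, ¬LateAt 𝒢 v₀ wait choice t) :
    completionTime 𝒢 v₀ wait choice ≤ ((Tabs (graphAt 𝒢 v₀ wait choice) : ℕ∞) : ℝ≥0∞) := by
  classical
  by_cases hex : ∃ t, 2 * (n : ℝ) ≤
      ∑ q ∈ Finset.range (t + 1), progress (graphAt 𝒢 v₀ wait choice q)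
  · have hmin : ((Nat.find hex : ℕ) : ℕ∞) ≤ Tabs (graphAt 𝒢 v₀ wait choice) :=
      le_iInf₂ fun t ht => Nat.cast_le.2 (Nat.find_min' hex ht)
    have hlt : ∑ q ∈ Finset.range (Nat.find hex), progress (graphAt 𝒢 v₀ wait choice q) <
        2 * n := by
      rcases hk : Nat.find hex with _ | k
      · simpa using hn
      · exact not_le.1 (Nat.find_min hex (hk ▸ Nat.lt_succ_self k))
    have hI : informedAt 𝒢 v₀ wait choice (Nat.find hex) = Finset.univ := by
      by_contra hI
      exact h _ ⟨hlt, Nat.find_spec hex, hI⟩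
    calc _ ≤ ((Nat.find hex : ℕ) : ℝ≥0∞) := completionTime_le hI
      _ = (((Nat.find hex : ℕ) : ℕ∞) : ℝ≥0∞) := by simp
      _ ≤ _ := ENat.toENNReal_le.2 hmin
  · have : Tabs (graphAt 𝒢 v₀ wait choice) = ⊤ := by
      exact iInf₂_eq_top.2 fun t ht => absurd ⟨t, ht⟩ hex
    simp [this]

end Pathwise

variable {Ω : Type*} [MeasurableSpace Ω] {μ : Measure Ω}
  {wait : Fin n → ℕ → Ω → ℝ} {choice : Fin n → ℕ → Ω → Finset (Fin n) → Fin n}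

/-- Given the history up to time `p`, a new node is informed during `[p, p + 1)` with probability at
least `1 - 1/e` times the progress of the graph. -/
theorem IsRandomClocks.measure_history_le_informed [IsProbabilityMeasure μ]
    (h : IsRandomClocks μ wait choice)
    (𝒢 : DynamicNetwork n) (v₀ : Fin n) (p : ℕ) (H : List (Finset (Fin n)))
    (hne : (H.headD ∅).Nonempty) (huniv : H.headD ∅ ≠ Finset.univ) :
    ENNReal.ofReal ((1 - Real.exp (-1)) * progress (𝒢 p H)) *
        μ {ω | history 𝒢 v₀ (fun u k => wait u k ω) (fun u k => choice u k ω) p = H} ≤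
      μ {ω | history 𝒢 v₀ (fun u k => wait u k ω) (fun u k => choice u k ω) p = H ∧
        (informedAt 𝒢 v₀ (fun u k => wait u k ω) (fun u k => choice u k ω) p).card <
        (informedAt 𝒢 v₀ (fun u k => wait u k ω) (fun u k => choice u k ω) (p + 1)).card} := by
  classical
  by_cases hG : (𝒢 p H).Connected
  · obtain ⟨u, v, huv, hcut, hle⟩ := exists_cut_edge hG hne huniv
    have hd : 0 < (𝒢 p H).degree u := ((𝒢 p H).degree_pos_iff_exists_adj u).2 ⟨v, huv⟩
    have h1 : 0 ≤ 1 - Real.exp (-1) := by simp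
    refine le_trans ?_ ((h.measure_history_le_contact 𝒢 v₀ p H (𝒢 p H) huv).trans
      (measure_mono ?_))
    · rw [ENNReal.ofReal_mul h1]
      refine mul_le_mul (mul_le_mul le_rfl ?_ zero_le zero_le) le_rfl zero_le zero_le
      rw [← ENNReal.ofReal_natCast, ← ENNReal.ofReal_inv_of_pos (by exact_mod_cast hd)]
      refine ENNReal.ofReal_le_ofReal ?_
      simpa [progress, ceilConductance, hG] using hle
    · rintro ω ⟨rfl, s, hs, hs', hc⟩
      exact ⟨rfl, card_informedAt_lt_succ hs hs' hc hcut⟩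
  · simp [progress, ceilConductance, hG]

theorem IsRandomClocks.measurableSet_history_informed (h : IsRandomClocks μ wait choice)
    (𝒢 : DynamicNetwork n) (v₀ : Fin n) (p : ℕ) (H : List (Finset (Fin n))) :
    MeasurableSet {ω | history 𝒢 v₀ (fun u k => wait u k ω) (fun u k => choice u k ω) p = H ∧
        (informedAt 𝒢 v₀ (fun u k => wait u k ω) (fun u k => choice u k ω) p).card <
        (informedAt 𝒢 v₀ (fun u k => wait u k ω) (fun u k => choice u k ω) (p + 1)).card} := by
  have : {ω | history 𝒢 v₀ (fun u k => wait u k ω) (fun u k => choice u k ω) p = H ∧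
        (informedAt 𝒢 v₀ (fun u k => wait u k ω) (fun u k => choice u k ω) p).card <
        (informedAt 𝒢 v₀ (fun u k => wait u k ω) (fun u k => choice u k ω) (p + 1)).card} =
      ⋃ (J : Finset (Fin n)) (_ : (H.headD ∅).card < J.card),
        {ω | history 𝒢 v₀ (fun u k => wait u k ω) (fun u k => choice u k ω) (p + 1) = J :: H} := by
    ext ω
    simp only [Set.mem_iUnion, Set.mem_ofPred_eq, informedAt, history, List.cons.injEq]
    constructor
    · rintro ⟨rfl, h2⟩
      exact ⟨_, h2, rfl, rfl⟩
    · rintro ⟨J, hJ, rfl, rfl⟩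
      exact ⟨rfl, hJ⟩
  rw [this]
  exact MeasurableSet.iUnion fun J => MeasurableSet.iUnion fun _ =>
    measurableSet_history_eq h.measurable_wait h.measurable_choice 𝒢 v₀ (p + 1) (J :: H)

/-- The supermartingale inequality on the event that the history up to time `p` is `H`. What the
potential loses by stopping at a late time is accounted for separately. -/
theorem IsRandomClocks.setLIntegral_potential_succ_le [IsProbabilityMeasure μ]
    (h : IsRandomClocks μ wait choice)
    (𝒢 : DynamicNetwork n) (v₀ : Fin n) (p : ℕ) (H : List (Finset (Fin n))) {A : Set Ω}
    (hA : A = {ω | history 𝒢 v₀ (fun u k => wait u k ω) (fun u k => choice u k ω) p = H}) :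
    ∫⁻ ω in A, ENNReal.ofReal
        (potential 𝒢 v₀ (fun u k => wait u k ω) (fun u k => choice u k ω) (p + 1)) ∂μ +
      ENNReal.ofReal (latePotential n) *
        μ (A ∩ {ω | LateAt 𝒢 v₀ (fun u k => wait u k ω) (fun u k => choice u k ω) p}) ≤
    ∫⁻ ω in A, ENNReal.ofReal
        (potential 𝒢 v₀ (fun u k => wait u k ω) (fun u k => choice u k ω) p) ∂μ := by
  have hAm : MeasurableSet A := by
    rw [hA]
    exact measurableSet_history_eq h.measurable_wait h.measurable_choice 𝒢 v₀ p H
  rcases A.eq_empty_or_nonempty with rfl | ⟨ω₀, hω₀⟩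
  · simp
  -- On `A` the informed set, the progress and the potential at time `p` have the values `I`,
  -- `S` and `x`, `z`.
  set I := H.headD ∅
  set x := progress (𝒢 p H)
  set S := totalProgress 𝒢 H - x
  have hH : ∀ ω ∈ A, history 𝒢 v₀ (fun u k => wait u k ω) (fun u k => choice u k ω) p = H :=
    fun ω hω => by simpa [hA] using hω
  have hI : ∀ ω ∈ A, informedAt 𝒢 v₀ (fun u k => wait u k ω) (fun u k => choice u k ω) p = I :=
    fun ω hω => by rw [informedAt, hH ω hω]
  have hx : ∀ ω ∈ A,
      progress (graphAt 𝒢 v₀ (fun u k => wait u k ω) (fun u k => choice u k ω) p) = x :=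
    fun ω hω => by rw [graphAt, hH ω hω]
  have hS' : ∀ ω ∈ A, ∑ q ∈ Finset.range (p + 1),
      progress (graphAt 𝒢 v₀ (fun u k => wait u k ω) (fun u k => choice u k ω) q) = S + x :=
    fun ω hω => by rw [← totalProgress_history, hH ω hω, sub_add_cancel]
  have hS : ∀ ω ∈ A, ∑ q ∈ Finset.range p,
      progress (graphAt 𝒢 v₀ (fun u k => wait u k ω) (fun u k => choice u k ω) q) = S := by
    intro ω hω
    have := hS' ω hω
    rw [Finset.sum_range_succ, hx ω hω] at this
    linarith
  have hx0 : 0 ≤ x := progress_nonneg _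
  by_cases hlow : S + x < 2 * n ∧ I ≠ Finset.univ
  · have hS2 : S < 2 * n := by linarith [hlow.1]
    set z : ℝ := (4 / 5) ^ I.card * Real.exp (rewardRate * S)
    have hz : ∀ ω ∈ A, potential 𝒢 v₀ (fun u k => wait u k ω) (fun u k => choice u k ω) p = z := by
      intro ω hω
      rw [potential, hS ω hω, hI ω hω, if_pos ⟨hS2, hlow.2⟩]
    have hz0 : 0 ≤ z := by positivity
    have hlate : A ∩ {ω | LateAt 𝒢 v₀ (fun u k => wait u k ω) (fun u k => choice u k ω) p} = ∅ := by
      refine Set.eq_empty_of_forall_notMem fun ω hω => ?_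
      have h2 := hω.2.2.1
      rw [hS' ω hω.1] at h2
      exact absurd hlow.1 (not_lt.2 h2)
    set B : Set Ω := {ω | history 𝒢 v₀ (fun u k => wait u k ω) (fun u k => choice u k ω) p = H ∧
        (informedAt 𝒢 v₀ (fun u k => wait u k ω) (fun u k => choice u k ω) p).card <
        (informedAt 𝒢 v₀ (fun u k => wait u k ω) (fun u k => choice u k ω) (p + 1)).card}
    have hBm : MeasurableSet B := h.measurableSet_history_informed 𝒢 v₀ p H
    have hBA : B ⊆ A := fun ω hω => by rw [hA]; exact hω.1
    have hB : (1 - Real.exp (-1)) * x * μ.real A ≤ μ.real B := by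
      have hne : I.Nonempty := by
        rw [← hI ω₀ hω₀]
        exact informedAt_nonempty 𝒢 v₀ p
      have h1 := h.measure_history_le_informed 𝒢 v₀ p H hne hlow.2
      rw [← hA] at h1
      have h2 := ENNReal.toReal_mono (measure_ne_top _ _) h1
      have h3 : 0 ≤ (1 - Real.exp (-1)) * progress (𝒢 p H) :=
        mul_nonneg (by simp) (progress_nonneg _)
      rwa [ENNReal.toReal_mul, ENNReal.toReal_ofReal h3] at h2
    set e := Real.exp (rewardRate * x)
    have hup : ∀ ω ∈ A, potential 𝒢 v₀ (fun u k => wait u k ω) (fun u k => choice u k ω) (p + 1) ≤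
        z * e * B.indicator (fun _ => 4 / 5) ω + z * e * (A \ B).indicator (fun _ => 1) ω := by
      intro ω hω
      have h1 := potential_succ_le (𝒢 := 𝒢) (v₀ := v₀) (wait := fun u k => wait u k ω)
        (choice := fun u k => choice u k ω) (t := p) (by rw [hI ω hω]; exact hlow.2)
        (by rw [hS ω hω]; exact hS2)
      rw [hz ω hω, hx ω hω] at h1
      refine h1.trans (le_of_eq ?_)
      by_cases hωB : ω ∈ B
      · simp [hωB, hωB.2, e]
      · have hωB' := fun hc => hωB ⟨hH ω hω, hc⟩
        rw [if_neg hωB']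
        simp [hωB, hω, e]
    have hmain : z * e * (4 / 5 * μ.real B + (μ.real A - μ.real B)) ≤ z * μ.real A := by
      have h1 : 4 / 5 * μ.real B + (μ.real A - μ.real B) ≤ (1 - rewardRate * x) * μ.real A := by
        unfold rewardRate
        linarith
      have h2 : 1 - rewardRate * x ≤ Real.exp (-(rewardRate * x)) := by
        linarith [Real.add_one_le_exp (-(rewardRate * x))]
      calc _ ≤ z * e * (Real.exp (-(rewardRate * x)) * μ.real A) := by
            refine mul_le_mul_of_nonneg_left (h1.trans ?_) (by positivity)
            exact mul_le_mul_of_nonneg_right h2 measureReal_nonneg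
        _ = z * (Real.exp (rewardRate * x) * Real.exp (-(rewardRate * x))) * μ.real A := by ring
        _ = z * μ.real A := by rw [← Real.exp_add]; simp
    rw [hlate, measure_empty, mul_zero, add_zero]
    calc _ ≤ ∫⁻ ω in A, (B.indicator (fun _ => ENNReal.ofReal (z * e * (4 / 5))) ω +
            (A \ B).indicator (fun _ => ENNReal.ofReal (z * e)) ω) ∂μ := by
          refine setLIntegral_mono' hAm fun ω hω => ?_
          refine (ENNReal.ofReal_le_ofReal (hup ω hω)).trans ?_
          by_cases hωB : ω ∈ B <;> simp [hωB, hω]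
      _ ≤ ENNReal.ofReal (z * e * (4 / 5)) * μ B + ENNReal.ofReal (z * e) * μ (A \ B) := by
          refine (setLIntegral_le_lintegral _ _).trans (le_of_eq ?_)
          rw [lintegral_add_left (measurable_const.indicator hBm), lintegral_indicator_const hBm,
            lintegral_indicator_const (hAm.diff hBm)]
      _ = ENNReal.ofReal (z * e * (4 / 5 * μ.real B + (μ.real A - μ.real B))) := by
          rw [← measureReal_sdiff hBA hBm, ← ofReal_measureReal (s := B),
            ← ofReal_measureReal (s := A \ B), ← ENNReal.ofReal_mul (by positivity),
            ← ENNReal.ofReal_mul (by positivity), ← ENNReal.ofReal_add (by positivity)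
            (by positivity)]
          congr 1
          ring
      _ ≤ ENNReal.ofReal (z * μ.real A) := ENNReal.ofReal_le_ofReal hmain
      _ = ∫⁻ ω in A, ENNReal.ofReal z ∂μ := by
          rw [setLIntegral_const, ENNReal.ofReal_mul hz0, ofReal_measureReal]
      _ = _ := setLIntegral_congr_fun hAm fun ω hω => by rw [hz ω hω]
  · have hzero : ∫⁻ ω in A, ENNReal.ofReal
        (potential 𝒢 v₀ (fun u k => wait u k ω) (fun u k => choice u k ω) (p + 1)) ∂μ = 0 := by
      rw [setLIntegral_congr_fun (g := fun _ => 0) hAm fun ω hω => ?_, lintegral_zero]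
      rw [potential_succ_eq_zero, ENNReal.ofReal_zero]
      rw [hS' ω hω, hI ω hω]
      rcases not_and_or.1 hlow with h1 | h1
      · exact .inl (not_lt.1 h1)
      · exact .inr (not_not.1 h1)
    rw [hzero, zero_add]
    have hlate : ∀ ω ∈ A, LateAt 𝒢 v₀ (fun u k => wait u k ω) (fun u k => choice u k ω) p ↔
        S < 2 * n ∧ 2 * n ≤ S + x ∧ I ≠ Finset.univ := fun ω hω => by
      rw [LateAt, hS ω hω, hS' ω hω, hI ω hω]
    by_cases hc : S < 2 * n ∧ 2 * n ≤ S + x ∧ I ≠ Finset.univ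
    · calc _ ≤ ENNReal.ofReal (latePotential n) * μ A :=
            mul_le_mul le_rfl (measure_mono Set.inter_subset_left) zero_le zero_le
        _ = ∫⁻ ω in A, ENNReal.ofReal (latePotential n) ∂μ := (setLIntegral_const _ _).symm
        _ ≤ _ := setLIntegral_mono' hAm fun ω hω =>
            ENNReal.ofReal_le_ofReal ((hlate ω hω).2 hc).latePotential_le
    · have hlateA : A ∩ {ω | LateAt 𝒢 v₀ (fun u k => wait u k ω) (fun u k => choice u k ω) p} =
          ∅ := Set.eq_empty_of_forall_notMem fun ω hω => hc ((hlate ω hω.1).1 hω.2)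
      simp [hlateA]

theorem IsRandomClocks.lintegral_potential_succ_le [IsProbabilityMeasure μ]
    (h : IsRandomClocks μ wait choice)
    (𝒢 : DynamicNetwork n) (v₀ : Fin n) (p : ℕ) :
    ∫⁻ ω, ENNReal.ofReal
        (potential 𝒢 v₀ (fun u k => wait u k ω) (fun u k => choice u k ω) (p + 1)) ∂μ +
      ENNReal.ofReal (latePotential n) *
        μ {ω | LateAt 𝒢 v₀ (fun u k => wait u k ω) (fun u k => choice u k ω) p} ≤
    ∫⁻ ω, ENNReal.ofReal
        (potential 𝒢 v₀ (fun u k => wait u k ω) (fun u k => choice u k ω) p) ∂μ := by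
  set A : List (Finset (Fin n)) → Set Ω := fun H =>
    {ω | history 𝒢 v₀ (fun u k => wait u k ω) (fun u k => choice u k ω) p = H}
  have hA : ∀ H, MeasurableSet (A H) := fun H =>
    measurableSet_history_eq h.measurable_wait h.measurable_choice 𝒢 v₀ p H
  have hdisj : Pairwise (Function.onFun Disjoint A) := fun H H' hne =>
    Set.disjoint_left.2 fun ω (h1 : _ = H) (h2 : _ = H') => hne (h1.symm.trans h2)
  have huniv : ⋃ H, A H = Set.univ := Set.eq_univ_of_forall fun ω => Set.mem_iUnion.2 ⟨_, rfl⟩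
  have hsplit : ∀ f : Ω → ℝ≥0∞, ∫⁻ ω, f ω ∂μ = ∑' H, ∫⁻ ω in A H, f ω ∂μ := fun f => by
    rw [← lintegral_iUnion hA hdisj, huniv, Measure.restrict_univ]
  have hlate : μ {ω | LateAt 𝒢 v₀ (fun u k => wait u k ω) (fun u k => choice u k ω) p} ≤
      ∑' H, μ (A H ∩ {ω | LateAt 𝒢 v₀ (fun u k => wait u k ω) (fun u k => choice u k ω) p}) := by
    refine le_trans (measure_mono fun ω hω => ?_) (measure_iUnion_le _)
    exact Set.mem_iUnion.2 ⟨_, rfl, hω⟩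
  rw [hsplit, hsplit]
  calc _ ≤ _ := add_le_add le_rfl (mul_le_mul le_rfl hlate zero_le zero_le)
    _ = _ := by rw [← ENNReal.tsum_mul_left, ← ENNReal.tsum_add]
    _ ≤ _ := ENNReal.tsum_le_tsum fun H => h.setLIntegral_potential_succ_le 𝒢 v₀ p H rfl

/-- The probability that some node is uninformed at time `Tabs` decays exponentially in `n`. -/
theorem IsRandomClocks.measure_Tabs_lt_completionTime_le [IsProbabilityMeasure μ]
    (h : IsRandomClocks μ wait choice)
    (hn : 0 < n) (𝒢 : DynamicNetwork n) (v₀ : Fin n) :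
    μ {ω | ((Tabs (graphAt 𝒢 v₀ (fun u k => wait u k ω) (fun u k => choice u k ω)) : ℕ∞) : ℝ≥0∞) <
        completionTime 𝒢 v₀ (fun u k => wait u k ω) (fun u k => choice u k ω)} ≤
      ENNReal.ofReal (latePotential n)⁻¹ := by
  set L : ℕ → Set Ω := fun p =>
    {ω | LateAt 𝒢 v₀ (fun u k => wait u k ω) (fun u k => choice u k ω) p}
  set Z : ℕ → ℝ≥0∞ := fun p => ∫⁻ ω, ENNReal.ofReal
    (potential 𝒢 v₀ (fun u k => wait u k ω) (fun u k => choice u k ω) p) ∂μ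
  have hZ0 : Z 0 ≤ 1 := by
    calc Z 0 ≤ ∫⁻ _, 1 ∂μ := lintegral_mono fun ω => by
            simpa using ENNReal.ofReal_le_ofReal potential_zero_le_one
      _ = 1 := by simp
  have htel : ∀ N, Z N + ∑ p ∈ Finset.range N, ENNReal.ofReal (latePotential n) * μ (L p) ≤ 1 := by
    intro N
    induction N with
    | zero => simpa using hZ0
    | succ N ih =>
      refine le_trans ?_ ih
      rw [Finset.sum_range_succ, add_comm (∑ p ∈ Finset.range N, _), ← add_assoc]
      exact add_le_add (h.lintegral_potential_succ_le 𝒢 v₀ N) le_rfl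
  have hsum : ENNReal.ofReal (latePotential n) * ∑' p, μ (L p) ≤ 1 := by
    rw [← ENNReal.tsum_mul_left, ENNReal.tsum_eq_iSup_nat]
    exact iSup_le fun N => le_add_self.trans (htel N)
  have hpos := latePotential_pos n
  calc _ ≤ μ (⋃ p, L p) := measure_mono fun ω hω => by
        by_contra hL
        simp only [Set.mem_iUnion, not_exists] at hL
        exact absurd (completionTime_le_Tabs hn hL) (not_le.2 hω)
    _ ≤ ∑' p, μ (L p) := measure_iUnion_le _
    _ ≤ (ENNReal.ofReal (latePotential n))⁻¹ := by
        rw [ENNReal.le_inv_iff_mul_le, mul_comm]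
        exact hsum
    _ = _ := (ENNReal.ofReal_inv_of_pos hpos).symm

end Supermartingale

/-! ### Conclusion -/

theorem eventually_inv_latePotential_le (c : ℝ) :
    ∀ᶠ n : ℕ in Filter.atTop, (latePotential n)⁻¹ ≤ (n : ℝ) ^ (-c) := by
  -- The base `(4/5) * exp (2 * rewardRate)` of `latePotential` exceeds `1`.
  have ha : 0 < Real.log (4 / 5) + 2 * rewardRate := by
    have h1 := Real.one_sub_inv_le_log_of_pos (show (0 : ℝ) < 4 / 5 by norm_num)
    have h2 := Real.exp_neg_one_lt_d9
    unfold rewardRate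
    norm_num at h1
    linarith
  set a := Real.log (4 / 5) + 2 * rewardRate
  have hlog : Filter.Tendsto (fun n : ℕ => a * n - c * Real.log n) Filter.atTop Filter.atTop := by
    have h1 : (fun x : ℝ => c * Real.log x) =o[Filter.atTop] fun x => x :=
      Real.isLittleO_log_id_atTop.const_mul_left c
    have h2 := (h1.comp_tendsto tendsto_natCast_atTop_atTop).bound (half_pos ha)
    refine Filter.tendsto_atTop_mono' _ ?_
      (tendsto_natCast_atTop_atTop.const_mul_atTop (half_pos ha))
    filter_upwards [h2] with n hn
    have h3 := (le_abs_self _).trans hn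
    simp only [Function.comp, RCLike.norm_natCast] at h3
    linarith
  filter_upwards [hlog.eventually_ge_atTop rewardRate, Filter.eventually_gt_atTop 0] with n hn hpos
  have hpos' : (0 : ℝ) < n := by exact_mod_cast hpos
  rw [Real.rpow_def_of_pos hpos', latePotential, ← Real.exp_log (show (0 : ℝ) < 4 / 5 by norm_num),
    ← Real.exp_nat_mul, ← Real.exp_add, ← Real.exp_neg]
  refine Real.exp_le_exp.2 ?_
  have : a * n = n * Real.log (4 / 5) + rewardRate * (2 * n) := by simp only [a]; ring
  linarith

/-- If all graphs are connected, then every graph contributes at least `1 / n`, and `Tabs` is at most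
`2 * n ^ 2`. -/
theorem Tabs_le_of_connected {n : ℕ} (hn : 2 ≤ n) {G : ℕ → SimpleGraph (Fin n)}
    (hG : ∀ t, (G t).Connected) : Tabs G ≤ ((2 * n ^ 2 : ℕ) : ℕ∞) := by
  refine iInf₂_le _ ?_
  have h0 : (0 : ℝ) < n := by exact_mod_cast (by omega : 0 < n)
  calc 2 * (n : ℝ) ≤ ((2 * n ^ 2 + 1 : ℕ) : ℝ) * (n : ℝ)⁻¹ := by
        rw [← div_eq_mul_inv, le_div_iff₀ h0]
        push_cast
        nlinarith
    _ = ∑ _p ∈ Finset.range (2 * n ^ 2 + 1), (n : ℝ)⁻¹ := by simp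
    _ ≤ _ := Finset.sum_le_sum fun p _ => inv_le_progress_of_connected (hG p) hn

end AsyncRumor

theorem theorem3 :
    (∀ c : ℝ, 1 < c → ∃ n₀ : ℕ, ∀ n : ℕ, n₀ ≤ n →
      ∀ (𝒢 : AsyncRumor.DynamicNetwork n) (v₀ : Fin n)
        (Ω : Type*) (_ : MeasurableSpace Ω) (μ : Measure Ω) (_ : IsProbabilityMeasure μ)
        (wait : Fin n → ℕ → Ω → ℝ) (choice : Fin n → ℕ → Ω → Finset (Fin n) → Fin n),
        AsyncRumor.IsRandomClocks μ wait choice →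
        μ {ω | ((AsyncRumor.Tabs (AsyncRumor.graphAt 𝒢 v₀ (fun u k => wait u k ω)
              (fun u k => choice u k ω)) : ℕ∞) : ℝ≥0∞) <
            AsyncRumor.completionTime 𝒢 v₀ (fun u k => wait u k ω) (fun u k => choice u k ω)} ≤
          ENNReal.ofReal ((n : ℝ) ^ (-c))) ∧
    (∃ C : ℝ, 0 < C ∧ ∀ c : ℝ, 1 < c → ∃ n₀ : ℕ, ∀ n : ℕ, n₀ ≤ n →
      ∀ (𝒢 : AsyncRumor.DynamicNetwork n) (v₀ : Fin n)
        (Ω : Type*) (_ : MeasurableSpace Ω) (μ : Measure Ω) (_ : IsProbabilityMeasure μ)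
        (wait : Fin n → ℕ → Ω → ℝ) (choice : Fin n → ℕ → Ω → Finset (Fin n) → Fin n),
        AsyncRumor.IsRandomClocks μ wait choice →
        (∀ᵐ ω ∂μ, ∀ t : ℕ, (AsyncRumor.graphAt 𝒢 v₀ (fun u k => wait u k ω)
          (fun u k => choice u k ω) t).Connected) →
        μ {ω | ENNReal.ofReal (C * (n : ℝ) ^ 2) <
            AsyncRumor.completionTime 𝒢 v₀ (fun u k => wait u k ω) (fun u k => choice u k ω)} ≤
          ENNReal.ofReal ((n : ℝ) ^ (-c))) := by
  refine ⟨fun c _ => ?_, 2, two_pos, fun c _ => ?_⟩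
  · obtain ⟨N, hN⟩ := Filter.eventually_atTop.1 (AsyncRumor.eventually_inv_latePotential_le c)
    refine ⟨max N 1, fun n hn 𝒢 v₀ Ω _ μ _ wait choice h => ?_⟩
    exact (h.measure_Tabs_lt_completionTime_le (le_of_max_le_right hn) 𝒢 v₀).trans
      (ENNReal.ofReal_le_ofReal (hN n (le_of_max_le_left hn)))
  · obtain ⟨N, hN⟩ := Filter.eventually_atTop.1 (AsyncRumor.eventually_inv_latePotential_le c)
    refine ⟨max N 2, fun n hn 𝒢 v₀ Ω _ μ _ wait choice h hconn => ?_⟩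
    have hn2 : 2 ≤ n := le_of_max_le_right hn
    refine le_trans (measure_mono_ae ?_) ((h.measure_Tabs_lt_completionTime_le (by omega) 𝒢
      v₀).trans
      (ENNReal.ofReal_le_ofReal (hN n (le_of_max_le_left hn))))
    filter_upwards [hconn] with ω hω hlt
    refine lt_of_le_of_lt ?_ hlt
    refine (ENat.toENNReal_le.2 (AsyncRumor.Tabs_le_of_connected hn2 hω)).trans (le_of_eq ?_)
    rw [ENat.toENNReal_coe, ← ENNReal.ofReal_natCast]
    push_cast
    rfl
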